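/- Let $X,Z$ be the Pauli matrices, $\epsilon\ge 0$, $0\le\nu<1$, $L_{\max}\in\mathbb N$ and $T_{\max}\in\mathbb R$. A single experiment on an unknown single-qubit Hamiltonian $H\in\{Z,\,Z+\epsilon X\}$ consists of: a pure initial state $|\psi\rangle$ of $N\ge 1$ qubits; an $N$-qubit operator $$U_{L+1}\bigl(e^{-it_L(H+\nu_LP_L)}\otimes I\bigr)U_L\cdots U_2\bigl(e^{-it_1(H+\nu_1P_1)}\otimes I\bigr)U_1 ,$$ where the $U_j$ are arbitrary $N$-qubit unitaries, $t_j\in\mathbb R$, $0\le\nu_j\le\nu$, the $P_j$ are traceless Hermitian single-qubit operators with eigenvalues $\pm1$, and $I$ is the identity on the other $N-1$ qubits; and a final POVM with finitely many outcomes. Its number of Hamiltonian evolutions is $L\ge 0$ and its evolution time is $\sum_j|t_j|$ (that is, $\sum_j t_j$ for nonnegative times). An adaptive strategy is a finite rooted tree in which every inner node $u$ carries an experiment whose outcomes correspond to the children of $u$; it starts at the root, moves to the child given by the measured outcome, and stops at a leaf. Let $p_\epsilon^{(\mathcal T)}$ and $p_0^{(\mathcal T)}$ be the distributions of the final leaf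 of the strategy $\mathcal T$ when $H=Z+\epsilon X$ and when $H=Z$, respectively. **Theorem.** If on every path of $\mathcal T$ from the root to a leaf the total number of Hamiltonian evolutions is at most $L_{\max}$ and the total evolution time is at most $T_{\max}$, then $$\mathrm{TV}\bigl(p_\epsilon^{(\mathcal T)},p_0^{(\mathcal T)}\bigr)\le 2\epsilon(2\nu+\epsilon)\,T_{\max}+\frac{\epsilon(2\nu+\epsilon+1)}{1-\nu}\,L_{\max}.$$ Here $\mathrm{TV}(p,q)=\frac12\sum_\ell|p(\ell)-q(\ell)|$. -/

import Mathlib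

open scoped Kronecker Matrix ComplexOrder

noncomputable section

namespace AdaptiveDiscrimination

/-- The Pauli matrix `X`. -/
def pauliX : Matrix (Fin 2) (Fin 2) ℂ := !![0, 1; 1, 0]

/-- The Pauli matrix `Z`. -/
def pauliZ : Matrix (Fin 2) (Fin 2) ℂ := !![1, 0; 0, -1]

/-- The computational basis of `a + 1` qubits. The first factor is the qubit on which the unknown
Hamiltonian acts, the second one indexes the basis of the remaining `a` qubits. -/
abbrev QubitBasis (a : ℕ) : Type := Fin 2 × (Fin a → Fin 2)

/-- One evolution under the unknown Hamiltonian in the presence of a magnetic field of strength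
at most `ν`, followed by a control unitary on all `a + 1` qubits. -/
structure Step (ν : ℝ) (a : ℕ) where
  /-- the evolution time -/
  time : ℝ
  /-- the field strength -/
  strength : ℝ
  strength_nonneg : 0 ≤ strength
  strength_le : strength ≤ ν
  /-- the field direction, a traceless Hermitian operator with eigenvalues `1` and `-1` -/
  direction : Matrix (Fin 2) (Fin 2) ℂ
  direction_isHermitian : direction.IsHermitian
  direction_trace : direction.trace = 0
  direction_spectrum : spectrum ℂ direction = {1, -1}
  /-- the unitary that is applied after the evolution -/
  control : Matrix.unitaryGroup (QubitBasis a) ℂ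

/-- The operator `U (exp (-i t (H + ν' P)) ⊗ I)` of a step. -/
def Step.operator {ν : ℝ} {a : ℕ} (s : Step ν a) (H : Matrix (Fin 2) (Fin 2) ℂ) :
    Matrix (QubitBasis a) (QubitBasis a) ℂ :=
  (s.control : Matrix (QubitBasis a) (QubitBasis a) ℂ) *
    (NormedSpace.exp ((-Complex.I * (s.time : ℂ)) • (H + (s.strength : ℂ) • s.direction)) ⊗ₖ
      (1 : Matrix (Fin a → Fin 2) (Fin a → Fin 2) ℂ))

/-- A single experiment with fields of strength at most `ν`: an initial pure state on
`N = ancillas + 1` qubits, an initial unitary, finitely many evolutions interleaved with control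
unitaries, and a final measurement (POVM) with finitely many outcomes. -/
structure Experiment (ν : ℝ) where
  /-- the number of qubits on which the Hamiltonian does not act -/
  ancillas : ℕ
  /-- the amplitudes of the initial state -/
  state : QubitBasis ancillas → ℂ
  state_normalized : ∑ j, ‖state j‖ ^ 2 = 1
  /-- the unitary that is applied before the first evolution -/
  initial : Matrix.unitaryGroup (QubitBasis ancillas) ℂ
  /-- the evolutions, in the order in which they are carried out -/
  steps : List (Step ν ancillas)
  /-- the number of outcomes of the measurement -/
  outcomes : ℕ
  /-- the POVM -/
  povm : Fin outcomes → Matrix (QubitBasis ancillas) (QubitBasis ancillas) ℂ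
  povm_posSemidef : ∀ i, (povm i).PosSemidef
  povm_sum : ∑ i, povm i = 1

namespace Experiment

variable {ν : ℝ}

/-- The operator `U_{L+1} (exp (-i t_L (H + ν_L P_L)) ⊗ I) U_L ⋯ (exp (-i t_1 (H + ν_1 P_1)) ⊗ I) U_1`
of the whole experiment. -/
def operator (E : Experiment ν) (H : Matrix (Fin 2) (Fin 2) ℂ) :
    Matrix (QubitBasis E.ancillas) (QubitBasis E.ancillas) ℂ :=
  E.steps.foldl (fun V s => s.operator H * V)
    (E.initial : Matrix (QubitBasis E.ancillas) (QubitBasis E.ancillas) ℂ)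

/-- The state before the measurement, if the unknown Hamiltonian is `H`. -/
def finalState (E : Experiment ν) (H : Matrix (Fin 2) (Fin 2) ℂ) : QubitBasis E.ancillas → ℂ :=
  E.operator H *ᵥ E.state

/-- The probability `⟨ψ| M_i |ψ⟩` of the outcome `i`, if the unknown Hamiltonian is `H`. -/
def outcomeProb (E : Experiment ν) (H : Matrix (Fin 2) (Fin 2) ℂ) (i : Fin E.outcomes) : ℝ :=
  (star (E.finalState H) ⬝ᵥ (E.povm i *ᵥ E.finalState H)).re

/-- The number of evolutions under the unknown Hamiltonian. -/
def numEvolutions (E : Experiment ν) : ℕ := E.steps.length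

/-- The total evolution time. Evolution times may be arbitrary reals and are counted with their
absolute value (so this is the plain sum if they are nonnegative). -/
def evolutionTime (E : Experiment ν) : ℝ := (E.steps.map fun s => |s.time|).sum

end Experiment

/-- An adaptive strategy with fields of strength at most `ν`, as a rooted tree: at an inner node an
experiment is carried out, and its outcome selects the child with which to go on; at a leaf the
strategy stops. -/
inductive Strategy (ν : ℝ) : Type where
  | leaf : Strategy ν
  | node (E : Experiment ν) (child : Fin E.outcomes → Strategy ν) : Strategy ν

namespace Strategy

variable {ν : ℝ}

/-- The leaves of the tree, equivalently the paths from the root to a leaf. -/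
def Leaf : Strategy ν → Type
  | leaf => Unit
  | node E child => Σ i : Fin E.outcomes, Leaf (child i)

instance instFintypeLeaf : (S : Strategy ν) → Fintype (Leaf S)
  | leaf => inferInstanceAs (Fintype Unit)
  | node E child =>
    haveI : ∀ i, Fintype (Leaf (child i)) := fun i => instFintypeLeaf (child i)
    inferInstanceAs (Fintype (Σ i : Fin E.outcomes, Leaf (child i)))

/-- The probability of ending at a given leaf, if the unknown Hamiltonian is `H`. -/
def leafProb (H : Matrix (Fin 2) (Fin 2) ℂ) : (S : Strategy ν) → Leaf S → ℝ
  | leaf, _ => 1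
  | node E child, ⟨i, l⟩ => E.outcomeProb H i * leafProb H (child i) l

/-- The number of evolutions under the unknown Hamiltonian on the path to a given leaf. -/
def pathEvolutions : (S : Strategy ν) → Leaf S → ℕ
  | leaf, _ => 0
  | node E child, ⟨i, l⟩ => E.numEvolutions + pathEvolutions (child i) l

/-- The total evolution time on the path to a given leaf. -/
def pathTime : (S : Strategy ν) → Leaf S → ℝ
  | leaf, _ => 0
  | node E child, ⟨i, l⟩ => E.evolutionTime + pathTime (child i) l

end Strategy

/-- The total variation distance of two distributions on a finite set. -/
def tvDist {α : Type*} [Fintype α] (p q : α → ℝ) : ℝ := (1 / 2) * ∑ x, |p x - q x|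

end AdaptiveDiscrimination

end

/-! A traceless Hermitian qubit operator is `r n` with `n² = 1` and `r` the length of its Bloch
vector, so its evolution is `cos(tr) - i sin(tr) n`. Adding `εX` changes the angle `tr` and the axis
`n`. As `X` is orthogonal to `Z`, the squared length changes only by `ε(2sx + ε)`, where `sx` is the
`X` component of the field; hence `r` changes by at most `ε(2ν + ε)`, which yields the time term.
The axis error does not grow with time and is paid once per evolution; both lengths are at least `1
- ν`, whence the denominator (`norm_exp_bloch_sub_exp_bloch_le`).

These errors add up along a product of unitaries (`norm_foldl_sub_foldl_le`), a measurement turns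
state distance into at most twice that `ℓ¹` distance (`sum_abs_sub_le_of_povm`), and an induction on
the tree charges each path its own total cost (`sum_abs_leafProb_sub_le`). -/

namespace AdaptiveDiscrimination

open scoped Matrix.Norms.L2Operator

/-! ### Exponentials of involutions and operator norms -/

/-- A matrix acts on an eigenspace through the exponential of the eigenvalue. -/
theorem exp_mul_of_mul_eq_smul {m : Type*} [Fintype m] [DecidableEq m] {A Q : Matrix m m ℂ} {c : ℂ}
    (h : A * Q = c • Q) : NormedSpace.exp A * Q = Complex.exp c • Q := by
  have hpow : ∀ k : ℕ, A ^ k * Q = c ^ k • Q := by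
    intro k
    induction k with
    | zero => simp
    | succ k ih => rw [pow_succ, mul_assoc, h, mul_smul_comm, ih, smul_smul, pow_succ']
  have h1 := (NormedSpace.exp_series_hasSum_exp' (𝕂 := ℂ) A).mul_right Q
  have h2 := (NormedSpace.exp_series_hasSum_exp' (𝕂 := ℂ) c).smul_const Q
  rw [← Complex.exp_eq_exp_ℂ] at h2
  refine h1.unique (h2.congr_fun ?_)
  intro k
  simp [hpow, smul_smul]

/-- Euler's formula for a matrix that squares to the identity. -/
theorem exp_smul_of_mul_self_eq_one {m : Type*} [Fintype m] [DecidableEq m] {n : Matrix m m ℂ}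
    (hn : n * n = 1) (x : ℝ) :
    NormedSpace.exp ((-Complex.I * (x : ℂ)) • n)
      = (Real.cos x : ℂ) • (1 : Matrix m m ℂ) - (Complex.I * (Real.sin x : ℂ)) • n := by
  -- The columns of `1 + n` and `1 - n` are eigenvectors of `n` for `1` and `-1`, and the two
  -- matrices sum to `2`.
  have h1 : ((-Complex.I * (x : ℂ)) • n) * (1 + n) = (-Complex.I * (x : ℂ)) • (1 + n) := by
    rw [smul_mul_assoc, mul_add, hn, mul_one, add_comm]
  have h2 : ((-Complex.I * (x : ℂ)) • n) * (1 - n) = (Complex.I * (x : ℂ)) • (1 - n) := by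
    rw [smul_mul_assoc, mul_sub, hn, mul_one, ← neg_sub 1 n, smul_neg, neg_mul, neg_smul, neg_neg]
  have e1 := exp_mul_of_mul_eq_smul h1
  have e2 := exp_mul_of_mul_eq_smul h2
  have hsum : NormedSpace.exp ((-Complex.I * (x : ℂ)) • n) = (1 / 2 : ℂ) •
      (NormedSpace.exp ((-Complex.I * (x : ℂ)) • n) * (1 + n)
        + NormedSpace.exp ((-Complex.I * (x : ℂ)) • n) * (1 - n)) := by
    rw [← mul_add, add_add_sub_cancel, mul_add, mul_one, ← two_smul ℂ, smul_smul]
    norm_num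
  have c1 : Complex.exp (-Complex.I * (x : ℂ)) = Real.cos x - Complex.I * Real.sin x := by
    rw [show -Complex.I * (x : ℂ) = ((-x : ℝ) : ℂ) * Complex.I by push_cast; ring,
      Complex.exp_mul_I, ← Complex.ofReal_cos, ← Complex.ofReal_sin, Real.cos_neg, Real.sin_neg]
    push_cast; ring
  have c2 : Complex.exp (Complex.I * (x : ℂ)) = Real.cos x + Complex.I * Real.sin x := by
    rw [mul_comm, Complex.exp_mul_I, ← Complex.ofReal_cos, ← Complex.ofReal_sin]; ring
  rw [hsum, e1, e2, c1, c2]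
  module

theorem norm_le_one_of_mem_unitary {m : Type*} [Fintype m] [DecidableEq m] {U : Matrix m m ℂ}
    (hU : U ∈ Matrix.unitaryGroup m ℂ) : ‖U‖ ≤ 1 := by
  cases isEmpty_or_nonempty m
  · have : U = 0 := Subsingleton.elim _ _
    simp [this]
  · exact (CStarRing.norm_of_mem_unitary hU).le

theorem norm_le_one_of_isHermitian_of_mul_self {m : Type*} [Fintype m] [DecidableEq m]
    {n : Matrix m m ℂ} (hn : n.IsHermitian) (hn2 : n * n = 1) : ‖n‖ ≤ 1 := by
  apply norm_le_one_of_mem_unitary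
  rw [Matrix.mem_unitaryGroup_iff, Matrix.star_eq_conjTranspose, hn.eq, hn2]

/-- Distance between the evolutions generated by `r₁ n₁` and `r₀ n₀`, with `n₁`, `n₀` involutions. -/
theorem norm_exp_sub_exp_le {m : Type*} [Fintype m] [DecidableEq m] {n₁ n₀ : Matrix m m ℂ}
    (h₁ : n₁.IsHermitian) (s₁ : n₁ * n₁ = 1) (s₀ : n₀ * n₀ = 1) (x₁ x₀ : ℝ) :
    ‖NormedSpace.exp ((-Complex.I * (x₁ : ℂ)) • n₁) - NormedSpace.exp ((-Complex.I * (x₀ : ℂ)) • n₀)‖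
      ≤ 2 * |x₁ - x₀| + ‖n₁ - n₀‖ := by
  rw [exp_smul_of_mul_self_eq_one s₁, exp_smul_of_mul_self_eq_one s₀]
  -- The cosine and the sine each contribute `|x₁ - x₀|`, which explains the factor 2; the axis
  -- change has weight `|sin x₀| ≤ 1`.
  have hdec : (Real.cos x₁ : ℂ) • (1 : Matrix m m ℂ) - (Complex.I * (Real.sin x₁ : ℂ)) • n₁
      - ((Real.cos x₀ : ℂ) • (1 : Matrix m m ℂ) - (Complex.I * (Real.sin x₀ : ℂ)) • n₀)
      = ((Real.cos x₁ - Real.cos x₀ : ℝ) : ℂ) • (1 : Matrix m m ℂ)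
        - (Complex.I * ((Real.sin x₁ - Real.sin x₀ : ℝ) : ℂ)) • n₁
        - (Complex.I * (Real.sin x₀ : ℂ)) • (n₁ - n₀) := by
    push_cast
    module
  have hone : ‖(1 : Matrix m m ℂ)‖ ≤ 1 := norm_le_one_of_mem_unitary (one_mem _)
  have hn : ‖n₁‖ ≤ 1 := norm_le_one_of_isHermitian_of_mul_self h₁ s₁
  have b1 : ‖((Real.cos x₁ - Real.cos x₀ : ℝ) : ℂ) • (1 : Matrix m m ℂ)‖ ≤ |x₁ - x₀| := by
    rw [norm_smul, Complex.norm_real, Real.norm_eq_abs]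
    calc _ ≤ |x₁ - x₀| * 1 := by
          refine mul_le_mul ?_ (by assumption) (by positivity) (by positivity)
          simpa [Real.dist_eq] using Real.lipschitzWith_cos.dist_le_mul x₁ x₀
      _ = _ := mul_one _
  have b2 : ‖(Complex.I * ((Real.sin x₁ - Real.sin x₀ : ℝ) : ℂ)) • n₁‖ ≤ |x₁ - x₀| := by
    rw [norm_smul, norm_mul, Complex.norm_I, one_mul, Complex.norm_real, Real.norm_eq_abs]
    calc _ ≤ |x₁ - x₀| * 1 := by
          refine mul_le_mul ?_ (by assumption) (by positivity) (by positivity)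
          simpa [Real.dist_eq] using Real.lipschitzWith_sin.dist_le_mul x₁ x₀
      _ = _ := mul_one _
  have b3 : ‖(Complex.I * (Real.sin x₀ : ℂ)) • (n₁ - n₀)‖ ≤ ‖n₁ - n₀‖ := by
    rw [norm_smul, norm_mul, Complex.norm_I, one_mul, Complex.norm_real, Real.norm_eq_abs]
    exact mul_le_of_le_one_left (norm_nonneg _) (Real.abs_sin_le_one _)
  rw [hdec]
  calc _ ≤ _ := norm_sub_le _ _
    _ ≤ _ := add_le_add_left (norm_sub_le _ _) _
    _ ≤ _ := by linarith

/-- The embedding `A ↦ A ⊗ I` as a homomorphism of star algebras. -/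
noncomputable def tensorOne (m k : Type*) [Fintype m] [DecidableEq m] [Fintype k] [DecidableEq k] :
    Matrix m m ℂ →⋆ₐ[ℂ] Matrix (m × k) (m × k) ℂ where
  toFun A := A ⊗ₖ (1 : Matrix k k ℂ)
  map_one' := Matrix.one_kronecker_one
  map_mul' A B := by rw [← Matrix.mul_kronecker_mul, mul_one]
  map_zero' := Matrix.zero_kronecker _
  map_add' A B := Matrix.add_kronecker _ _ _
  commutes' c := by
    rw [Algebra.algebraMap_eq_smul_one, Algebra.algebraMap_eq_smul_one, Matrix.smul_kronecker,
      Matrix.one_kronecker_one]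
  map_star' A := by
    simp [Matrix.star_eq_conjTranspose, Matrix.conjTranspose_kronecker]

/-- Star homomorphisms between C⋆-algebras are contractive. -/
theorem norm_kronecker_one_le {m k : Type*} [Fintype m] [DecidableEq m] [Fintype k] [DecidableEq k]
    (A : Matrix m m ℂ) : ‖A ⊗ₖ (1 : Matrix k k ℂ)‖ ≤ ‖A‖ :=
  NonUnitalStarAlgHom.norm_apply_le (tensorOne m k) A

theorem exp_mem_unitaryGroup_of_isHermitian {m : Type*} [Fintype m] [DecidableEq m]
    {A : Matrix m m ℂ} (hA : A.IsHermitian) (t : ℝ) :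
    NormedSpace.exp ((-Complex.I * (t : ℂ)) • A) ∈ Matrix.unitaryGroup m ℂ := by
  let _ : NormedAlgebra ℚ (Matrix m m ℂ) := NormedAlgebra.restrictScalars ℚ ℂ _
  apply NormedSpace.exp_mem_unitary_of_mem_skewAdjoint
  rw [skewAdjoint.mem_iff, Matrix.star_eq_conjTranspose, Matrix.conjTranspose_smul, hA.eq]
  simp

/-! ### Measurements and the distance of states -/

theorem re_star_dotProduct_self {m : Type*} [Fintype m] (u : m → ℂ) :
    (star u ⬝ᵥ u).re = ‖WithLp.toLp 2 u‖ ^ 2 := by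
  rw [EuclideanSpace.norm_sq_eq, dotProduct, Complex.re_sum]
  refine Finset.sum_congr rfl fun i _ => ?_
  rw [Pi.star_apply, Complex.star_def, ← Complex.normSq_eq_conj_mul_self, Complex.ofReal_re,
    Complex.normSq_eq_norm_sq]

/-- Factoring `M = B⋆B` makes outcome probabilities squared norms, to which the triangle and
Cauchy–Schwarz inequalities apply. -/
theorem exists_re_star_dotProduct_eq_norm_sq {m : Type*} [Fintype m] [DecidableEq m]
    {M : Matrix m m ℂ} (hM : M.PosSemidef) :
    ∃ B : Matrix m m ℂ, ∀ u, (star u ⬝ᵥ (M *ᵥ u)).re = ‖WithLp.toLp 2 (B *ᵥ u)‖ ^ 2 := by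
  obtain ⟨B, rfl⟩ : ∃ B : Matrix m m ℂ, M = star B * B := by
    open scoped MatrixOrder in
    exact CStarAlgebra.nonneg_iff_eq_star_mul_self.mp hM.nonneg
  refine ⟨B, fun u => ?_⟩
  rw [← re_star_dotProduct_self, Matrix.star_mulVec, ← Matrix.dotProduct_mulVec,
    Matrix.mulVec_mulVec, Matrix.star_eq_conjTranspose]

theorem sum_re_star_dotProduct_povm {m : Type*} [Fintype m] [DecidableEq m] {k : ℕ}
    {M : Fin k → Matrix m m ℂ} (hsum : ∑ i, M i = 1) (u : m → ℂ) :
    ∑ i, (star u ⬝ᵥ (M i *ᵥ u)).re = ‖WithLp.toLp 2 u‖ ^ 2 := by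
  rw [← Complex.re_sum, ← dotProduct_sum, ← Matrix.sum_mulVec, hsum, Matrix.one_mulVec,
    re_star_dotProduct_self]

/-- A measurement distinguishes two states at most by twice their distance. -/
theorem sum_abs_sub_le_of_povm {m : Type*} [Fintype m] [DecidableEq m] {k : ℕ}
    {M : Fin k → Matrix m m ℂ} (hM : ∀ i, (M i).PosSemidef) (hsum : ∑ i, M i = 1)
    {u v : m → ℂ} (hu : ‖WithLp.toLp 2 u‖ ≤ 1) (hv : ‖WithLp.toLp 2 v‖ ≤ 1) :
    ∑ i, |(star u ⬝ᵥ (M i *ᵥ u)).re - (star v ⬝ᵥ (M i *ᵥ v)).re|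
      ≤ 2 * ‖WithLp.toLp 2 u - WithLp.toLp 2 v‖ := by
  choose B hB using fun i => exists_re_star_dotProduct_eq_norm_sq (hM i)
  have htotal : ∀ w : m → ℂ, ∑ i, ‖WithLp.toLp 2 (B i *ᵥ w)‖ ^ 2 = ‖WithLp.toLp 2 w‖ ^ 2 := by
    intro w
    simp only [← hB]
    exact sum_re_star_dotProduct_povm hsum w
  -- `a² - b² = (a + b)(a - b)`, with the reverse triangle inequality for the second factor.
  have hterm : ∀ i, |(star u ⬝ᵥ (M i *ᵥ u)).re - (star v ⬝ᵥ (M i *ᵥ v)).re|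
      ≤ ‖WithLp.toLp 2 (B i *ᵥ (u - v))‖ * ‖WithLp.toLp 2 (B i *ᵥ u)‖
        + ‖WithLp.toLp 2 (B i *ᵥ (u - v))‖ * ‖WithLp.toLp 2 (B i *ᵥ v)‖ := by
    intro i
    rw [hB, hB, sq_sub_sq, abs_mul, Matrix.mulVec_sub, WithLp.toLp_sub, ← mul_add, mul_comm]
    refine mul_le_mul (abs_norm_sub_norm_le _ _) ?_ (abs_nonneg _) (norm_nonneg _)
    rw [abs_of_nonneg (by positivity)]
  have hcs : ∀ w : m → ℂ, ‖WithLp.toLp 2 w‖ ≤ 1 →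
      ∑ i, ‖WithLp.toLp 2 (B i *ᵥ (u - v))‖ * ‖WithLp.toLp 2 (B i *ᵥ w)‖
        ≤ ‖WithLp.toLp 2 (u - v)‖ := by
    intro w hw
    refine (Real.sum_mul_le_sqrt_mul_sqrt _ _ _).trans ?_
    rw [htotal, htotal, Real.sqrt_sq (norm_nonneg _), Real.sqrt_sq (norm_nonneg _)]
    exact mul_le_of_le_one_right (norm_nonneg _) hw
  calc _ ≤ _ := Finset.sum_le_sum fun i _ => hterm i
    _ = _ := Finset.sum_add_distrib
    _ ≤ _ := add_le_add (hcs u hu) (hcs v hv)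
    _ = _ := by rw [WithLp.toLp_sub]; ring

/-! ### Bloch vectors and the perturbation of one evolution -/

/-- The traceless Hermitian matrix with the given Bloch vector. -/
noncomputable def bloch (x y z : ℝ) : Matrix (Fin 2) (Fin 2) ℂ :=
  !![(z : ℂ), x - Complex.I * y; x + Complex.I * y, -z]

/-- The Bloch vector of a traceless Hermitian matrix with eigenvalues `1` and `-1`. -/
theorem exists_bloch_vector {P : Matrix (Fin 2) (Fin 2) ℂ} (hP : P.IsHermitian)
    (htr : P.trace = 0) (hspec : spectrum ℂ P = {1, -1}) :
    ∃ x y z : ℝ, x ^ 2 + y ^ 2 + z ^ 2 = 1 ∧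
      P = bloch x y z := by
  have h00 := congrArg Complex.im (hP.apply 0 0)
  have h01 := hP.apply 0 1
  have h11 : P 1 1 = -P 0 0 := by
    rw [Matrix.trace_fin_two] at htr
    linear_combination htr
  -- For trace zero this determinant is `1 - (x² + y² + z²)`, so the eigenvalue `1` alone fixes the
  -- length.
  have hdet : (1 - P).det = 0 := by
    have h1 : (1 : ℂ) ∈ spectrum ℂ P := by simp [hspec]
    by_contra h
    apply h1
    rw [spectrum.mem_resolventSet_iff, map_one, Matrix.isUnit_iff_isUnit_det]
    exact isUnit_iff_ne_zero.mpr h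
  have hz : P 0 0 = ((P 0 0).re : ℂ) := by
    apply Complex.ext <;> simp at h00 ⊢
    linarith
  have h10 : P 1 0 = (P 1 0).re + Complex.I * (P 1 0).im := by
    rw [mul_comm, Complex.re_add_im]
  have h01' : P 0 1 = (P 1 0).re - Complex.I * (P 1 0).im := by
    rw [← h01]
    apply Complex.ext <;> simp
  refine ⟨(P 1 0).re, (P 1 0).im, (P 0 0).re, ?_, ?_⟩
  · rw [Matrix.det_fin_two] at hdet
    simp only [Matrix.sub_apply, Matrix.one_apply_eq, h11, Matrix.one_apply_ne (zero_ne_one' (Fin 2)),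
      Matrix.one_apply_ne (one_ne_zero' (Fin 2))] at hdet
    rw [hz, h01', h10] at hdet
    have h : (((P 1 0).re ^ 2 + (P 1 0).im ^ 2 + (P 0 0).re ^ 2 : ℝ) : ℂ) = (1 : ℝ) := by
      simp only [Complex.add_re, Complex.add_im, Complex.mul_re, Complex.mul_im, Complex.ofReal_re,
        Complex.ofReal_im, Complex.I_re, Complex.I_im] at hdet
      push_cast
      ring_nf at hdet ⊢
      rw [Complex.I_sq] at hdet
      linear_combination -hdet
    exact_mod_cast h
  · ext i j
    fin_cases i <;> fin_cases j
    · exact hz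
    · exact h01'
    · exact h10
    · exact h11.trans (congrArg _ hz)

theorem bloch_isHermitian (x y z : ℝ) : (bloch x y z).IsHermitian := by
  ext i j
  fin_cases i <;> fin_cases j <;> simp [bloch, sub_eq_add_neg]

/-- Distinct Pauli matrices anticommute, so the cross terms cancel. -/
theorem bloch_mul_self (x y z : ℝ) :
    bloch x y z * bloch x y z = ((x ^ 2 + y ^ 2 + z ^ 2 : ℝ) : ℂ) • 1 := by
  ext i j
  fin_cases i <;> fin_cases j <;>
    simp [bloch, Matrix.mul_apply, Fin.sum_univ_two] <;> ring_nf <;> simp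

theorem smul_bloch_mul_self {x y z r : ℝ} (hr : 0 < r) (h : x ^ 2 + y ^ 2 + z ^ 2 = r ^ 2) :
    ((r⁻¹ : ℝ) : ℂ) • bloch x y z * ((r⁻¹ : ℝ) : ℂ) • bloch x y z = 1 := by
  have hr' : (r : ℂ) ≠ 0 := by exact_mod_cast hr.ne'
  rw [smul_mul_assoc, mul_smul_comm, bloch_mul_self, h, smul_smul, smul_smul]
  convert one_smul ℂ _
  push_cast
  field_simp

theorem norm_bloch_le {x y z r : ℝ} (hr : 0 < r) (h : x ^ 2 + y ^ 2 + z ^ 2 = r ^ 2) :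
    ‖bloch x y z‖ ≤ r := by
  have h1 := norm_le_one_of_isHermitian_of_mul_self (n := ((r⁻¹ : ℝ) : ℂ) • bloch x y z)
    (by rw [Matrix.IsHermitian, Matrix.conjTranspose_smul, bloch_isHermitian]; simp)
    (smul_bloch_mul_self hr h)
  rw [norm_smul, Complex.norm_real, Real.norm_eq_abs, abs_of_pos (inv_pos.mpr hr)] at h1
  rwa [inv_mul_le_iff₀ hr, mul_one] at h1

/-- The effect of a perturbation of strength `ε` in the direction `X` on a single evolution. -/
theorem norm_exp_bloch_sub_exp_bloch_le {ε ν s x y z t : ℝ} (hε : 0 ≤ ε) (hs : 0 ≤ s)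
    (hsν : s ≤ ν) (hν : ν < 1) (h : x ^ 2 + y ^ 2 + z ^ 2 = 1) :
    ‖NormedSpace.exp ((-Complex.I * (t : ℂ)) • bloch (s * x + ε) (s * y) (1 + s * z))
        - NormedSpace.exp ((-Complex.I * (t : ℂ)) • bloch (s * x) (s * y) (1 + s * z))‖
      ≤ 2 * ε * (2 * ν + ε) * |t| + ε * (2 * ν + ε + 1) / (1 - ν) := by
  obtain ⟨r₁, hr₁⟩ : ∃ r, r = √((s * x + ε) ^ 2 + (s * y) ^ 2 + (1 + s * z) ^ 2) := ⟨_, rfl⟩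
  obtain ⟨r₀, hr₀⟩ : ∃ r, r = √((s * x) ^ 2 + (s * y) ^ 2 + (1 + s * z) ^ 2) := ⟨_, rfl⟩
  have q₁ : (s * x + ε) ^ 2 + (s * y) ^ 2 + (1 + s * z) ^ 2 = r₁ ^ 2 := by
    rw [hr₁, Real.sq_sqrt (by positivity)]
  have q₀ : (s * x) ^ 2 + (s * y) ^ 2 + (1 + s * z) ^ 2 = r₀ ^ 2 := by
    rw [hr₀, Real.sq_sqrt (by positivity)]
  have n₁ : 0 ≤ r₁ := hr₁ ▸ Real.sqrt_nonneg _
  have n₀ : 0 ≤ r₀ := hr₀ ▸ Real.sqrt_nonneg _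
  have hz : -1 ≤ z := by nlinarith [sq_nonneg x, sq_nonneg y]
  have hx : |x| ≤ 1 := by
    rw [← sq_le_one_iff_abs_le_one]; nlinarith [sq_nonneg z, sq_nonneg y]
  -- The worst field points along `-Z`; the `Z` component alone then bounds both lengths from below.
  have hsz : 1 - ν ≤ 1 + s * z := by nlinarith
  have l₁ : 1 - ν ≤ r₁ := hsz.trans (abs_le_of_sq_le_sq'
    (by nlinarith [sq_nonneg (s * x + ε), sq_nonneg (s * y)]) n₁).2
  have l₀ : 1 - ν ≤ r₀ := hsz.trans (abs_le_of_sq_le_sq'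
    (by nlinarith [sq_nonneg (s * x), sq_nonneg (s * y)]) n₀).2
  have p₁ : 0 < r₁ := by linarith
  have p₀ : 0 < r₀ := by linarith
  have hdiff : |r₁ - r₀| * (r₁ + r₀) = ε * |2 * (s * x) + ε| := by
    have h' : (r₁ - r₀) * (r₁ + r₀) = ε * (2 * (s * x) + ε) := by linear_combination q₀ - q₁
    simpa only [abs_mul, abs_of_pos (add_pos p₁ p₀), abs_of_nonneg hε] using congrArg abs h'
  have hsx : |s * x| ≤ ν := by
    rw [abs_mul, abs_of_nonneg hs]
    exact (mul_le_of_le_one_right hs hx).trans hsν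
  have hd : |r₁ - r₀| ≤ ε * (2 * ν + ε) := by
    -- If `ν ≥ 1/2`, then `|r₁ - r₀| ≤ ε` suffices since `2ν ≥ 1`. Otherwise `r₁ + r₀ ≥ 2(1 - ν) ≥
    -- 1` and can be dropped from `hdiff`.
    rcases le_total (1 / 2) ν with hν' | hν'
    · have a₁ : |s * x + ε| ≤ r₁ := abs_le_of_sq_le_sq
        (by nlinarith [sq_nonneg (s * y), sq_nonneg (1 + s * z)]) n₁
      have a₀ : |s * x| ≤ r₀ := abs_le_of_sq_le_sq
        (by nlinarith [sq_nonneg (s * y), sq_nonneg (1 + s * z)]) n₀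
      have a : |2 * (s * x) + ε| ≤ r₁ + r₀ := by
        rw [show 2 * (s * x) + ε = (s * x + ε) + s * x by ring]
        exact (abs_add_le _ _).trans (add_le_add a₁ a₀)
      have : |r₁ - r₀| ≤ ε := by
        refine le_of_mul_le_mul_right ?_ (add_pos p₁ p₀)
        rw [hdiff]
        exact mul_le_mul_of_nonneg_left a hε
      nlinarith
    · have a : |2 * (s * x) + ε| ≤ 2 * ν + ε := by
        rw [abs_le] at hsx ⊢
        constructor <;> linarith [hsx.1, hsx.2]
      calc |r₁ - r₀| ≤ |r₁ - r₀| * (r₁ + r₀) :=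
            le_mul_of_one_le_right (abs_nonneg _) (by linarith)
        _ = ε * |2 * (s * x) + ε| := hdiff
        _ ≤ _ := mul_le_mul_of_nonneg_left a hε
  set A₁ := bloch (s * x + ε) (s * y) (1 + s * z) with hA₁
  set A₀ := bloch (s * x) (s * y) (1 + s * z) with hA₀
  have hAA : A₁ - A₀ = bloch ε 0 0 := by
    ext i j
    fin_cases i <;> fin_cases j <;> simp [hA₁, hA₀, bloch]
  have hX : ‖A₁ - A₀‖ ≤ ε := by
    -- `norm_bloch_le` needs a positive radius.
    rcases hε.eq_or_lt with h0 | h0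
    · rw [hAA, ← h0]
      have : bloch 0 0 0 = 0 := by
        ext i j
        fin_cases i <;> fin_cases j <;> simp [bloch]
      simp [this]
    · rw [hAA]
      exact norm_bloch_le h0 (by ring)
  have hn : ‖((r₁⁻¹ : ℝ) : ℂ) • A₁ - ((r₀⁻¹ : ℝ) : ℂ) • A₀‖ ≤ (ε + |r₁ - r₀|) / (1 - ν) := by
    -- Keeping `A₁` in the second term, of norm at most `r₁`, leaves only `r₀` in the denominator.
    have hdec : ((r₁⁻¹ : ℝ) : ℂ) • A₁ - ((r₀⁻¹ : ℝ) : ℂ) • A₀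
        = ((r₀⁻¹ : ℝ) : ℂ) • (A₁ - A₀) + ((r₁⁻¹ - r₀⁻¹ : ℝ) : ℂ) • A₁ := by
      push_cast
      module
    have e : |r₁⁻¹ - r₀⁻¹| * r₁ = r₀⁻¹ * |r₁ - r₀| := by
      have h' : (r₁⁻¹ - r₀⁻¹) * r₁ = r₀⁻¹ * (r₀ - r₁) := by field_simp
      simpa only [abs_mul, abs_of_pos p₁, abs_of_pos (inv_pos.mpr p₀), abs_sub_comm r₀] using
        congrArg abs h'
    calc _ ≤ r₀⁻¹ * ε + |r₁⁻¹ - r₀⁻¹| * r₁ := by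
          rw [hdec]
          refine (norm_add_le _ _).trans (add_le_add ?_ ?_)
          · rw [norm_smul, Complex.norm_real, Real.norm_eq_abs, abs_of_pos (inv_pos.mpr p₀)]
            gcongr
          · rw [norm_smul, Complex.norm_real, Real.norm_eq_abs]
            exact mul_le_mul_of_nonneg_left (norm_bloch_le p₁ q₁) (abs_nonneg _)
      _ = (ε + |r₁ - r₀|) / r₀ := by rw [e]; ring
      _ ≤ _ := by gcongr
  -- Normalizing the axis moves the length into the angle, which becomes `t * r`.
  have hscale : ∀ {r : ℝ} (A : Matrix (Fin 2) (Fin 2) ℂ), 0 < r →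
      (-Complex.I * (t : ℂ)) • A = (-Complex.I * ((t * r : ℝ) : ℂ)) • (((r⁻¹ : ℝ) : ℂ) • A) := by
    intro r A hr
    have hr' : (r : ℂ) ≠ 0 := by exact_mod_cast hr.ne'
    rw [smul_smul]
    congr 1
    push_cast
    field_simp
  rw [hscale A₁ p₁, hscale A₀ p₀]
  refine (norm_exp_sub_exp_le ?_ (smul_bloch_mul_self p₁ q₁) (smul_bloch_mul_self p₀ q₀) _ _).trans ?_
  · rw [Matrix.IsHermitian, Matrix.conjTranspose_smul, bloch_isHermitian]; simp
  · have h1 : 2 * |t * r₁ - t * r₀| ≤ 2 * ε * (2 * ν + ε) * |t| := by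
      rw [← mul_sub, abs_mul]
      nlinarith [mul_le_mul_of_nonneg_left hd (abs_nonneg t)]
    -- The numerator is `ε + ε(2ν + ε) = ε(2ν + ε + 1)`.
    refine add_le_add h1 (hn.trans ?_)
    have : 0 < 1 - ν := by linarith
    gcongr
    linarith

/-! ### The two Hamiltonians and sequences of evolutions -/

theorem pauliZ_eq_bloch : pauliZ = bloch 0 0 1 := by
  simp [pauliZ, bloch]

theorem pauliX_eq_bloch : pauliX = bloch 1 0 0 := by
  simp [pauliX, bloch]

theorem pauliZ_add_smul_bloch (s x y z : ℝ) :
    pauliZ + (s : ℂ) • bloch x y z = bloch (s * x) (s * y) (1 + s * z) := by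
  ext i j
  fin_cases i <;> fin_cases j <;> simp [pauliZ, bloch] <;> ring

theorem pauliZ_add_smul_pauliX_add_smul_bloch (ε s x y z : ℝ) :
    pauliZ + (ε : ℂ) • pauliX + (s : ℂ) • bloch x y z
      = bloch (s * x + ε) (s * y) (1 + s * z) := by
  ext i j
  fin_cases i <;> fin_cases j <;> simp [pauliZ, pauliX, bloch] <;> ring

theorem pauliZ_isHermitian : pauliZ.IsHermitian :=
  pauliZ_eq_bloch ▸ bloch_isHermitian 0 0 1

theorem pauliZ_add_smul_pauliX_isHermitian (ε : ℝ) : (pauliZ + (ε : ℂ) • pauliX).IsHermitian := by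
  have h := bloch_isHermitian 1 0 0
  rw [← pauliX_eq_bloch] at h
  refine pauliZ_isHermitian.add ?_
  rw [Matrix.IsHermitian, Matrix.conjTranspose_smul, h.eq]
  simp

theorem Step.operator_mem_unitaryGroup {ν : ℝ} {a : ℕ} (s : Step ν a)
    {H : Matrix (Fin 2) (Fin 2) ℂ} (hH : H.IsHermitian) :
    s.operator H ∈ Matrix.unitaryGroup (QubitBasis a) ℂ := by
  refine mul_mem s.control.2 (Matrix.kronecker_mem_unitary ?_ (one_mem _))
  refine exp_mem_unitaryGroup_of_isHermitian (hH.add ?_) _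
  rw [Matrix.IsHermitian, Matrix.conjTranspose_smul, s.direction_isHermitian.eq]
  simp

theorem Step.norm_operator_sub_operator_le {ν ε : ℝ} (hε : 0 ≤ ε) (hν : ν < 1) {a : ℕ}
    (s : Step ν a) :
    ‖s.operator (pauliZ + (ε : ℂ) • pauliX) - s.operator pauliZ‖
      ≤ 2 * ε * (2 * ν + ε) * |s.time| + ε * (2 * ν + ε + 1) / (1 - ν) := by
  obtain ⟨x, y, z, h, hP⟩ :=
    exists_bloch_vector s.direction_isHermitian s.direction_trace s.direction_spectrum
  have hK : ∀ A B : Matrix (Fin 2) (Fin 2) ℂ,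
      A ⊗ₖ (1 : Matrix (Fin a → Fin 2) (Fin a → Fin 2) ℂ) - B ⊗ₖ 1 = (A - B) ⊗ₖ 1 := by
    intro A B
    exact (map_sub (tensorOne (Fin 2) (Fin a → Fin 2)) A B).symm
  rw [Step.operator, Step.operator, ← mul_sub, hK]
  calc _ ≤ _ := norm_mul_le _ _
    _ ≤ _ := mul_le_of_le_one_left (norm_nonneg _) (norm_le_one_of_mem_unitary s.control.2)
    _ ≤ _ := norm_kronecker_one_le _
    _ ≤ _ := by
      rw [hP, pauliZ_add_smul_bloch, pauliZ_add_smul_pauliX_add_smul_bloch]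
      exact norm_exp_bloch_sub_exp_bloch_le hε s.strength_nonneg s.strength_le hν h

theorem foldl_mem_unitaryGroup {ν : ℝ} {a : ℕ} {H : Matrix (Fin 2) (Fin 2) ℂ} (hH : H.IsHermitian)
    (l : List (Step ν a)) {V : Matrix (QubitBasis a) (QubitBasis a) ℂ}
    (hV : V ∈ Matrix.unitaryGroup (QubitBasis a) ℂ) :
    l.foldl (fun V s => s.operator H * V) V ∈ Matrix.unitaryGroup (QubitBasis a) ℂ := by
  induction l generalizing V with
  | nil => exact hV
  | cons s l ih => exact ih (mul_mem (s.operator_mem_unitaryGroup hH) hV)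

/-- The deviations of the single evolutions add up. -/
theorem norm_foldl_sub_foldl_le {ν α β : ℝ} {a : ℕ} {H₁ H₀ : Matrix (Fin 2) (Fin 2) ℂ}
    (h₁ : H₁.IsHermitian) (h₀ : H₀.IsHermitian)
    (hstep : ∀ s : Step ν a, ‖s.operator H₁ - s.operator H₀‖ ≤ α * |s.time| + β)
    (l : List (Step ν a)) {V W : Matrix (QubitBasis a) (QubitBasis a) ℂ}
    (hW : W ∈ Matrix.unitaryGroup (QubitBasis a) ℂ) :
    ‖l.foldl (fun V s => s.operator H₁ * V) V - l.foldl (fun V s => s.operator H₀ * V) W‖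
      ≤ ‖V - W‖ + (α * (l.map fun s => |s.time|).sum + β * l.length) := by
  induction l generalizing V W with
  | nil => simp
  | cons s l ih =>
    refine (ih (V := s.operator H₁ * V) (mul_mem (s.operator_mem_unitaryGroup h₀) hW)).trans ?_
    -- Hybrid argument: old error passes through a unitary, and the new error acts on a unitary.
    have hdec : s.operator H₁ * V - s.operator H₀ * W
        = s.operator H₁ * (V - W) + (s.operator H₁ - s.operator H₀) * W := by noncomm_ring
    have hb : ‖s.operator H₁ * V - s.operator H₀ * W‖ ≤ ‖V - W‖ + (α * |s.time| + β) := by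
      rw [hdec]
      refine (norm_add_le _ _).trans (add_le_add ?_ ?_)
      · exact (norm_mul_le _ _).trans (mul_le_of_le_one_left (norm_nonneg _)
          (norm_le_one_of_mem_unitary (s.operator_mem_unitaryGroup h₁)))
      · exact (norm_mul_le _ _).trans ((mul_le_of_le_one_right (norm_nonneg _)
          (norm_le_one_of_mem_unitary hW)).trans (hstep s))
    simp only [List.map_cons, List.sum_cons, List.length_cons, Nat.cast_add, Nat.cast_one]
    linarith

/-! ### Outcome distributions of one experiment -/

namespace Experiment

variable {ν : ℝ} (E : Experiment ν)

theorem norm_state : ‖WithLp.toLp 2 E.state‖ = 1 := by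
  rw [← pow_eq_one_iff_of_nonneg (norm_nonneg _) two_ne_zero, EuclideanSpace.norm_sq_eq]
  exact E.state_normalized

theorem operator_mem_unitaryGroup {H : Matrix (Fin 2) (Fin 2) ℂ} (hH : H.IsHermitian) :
    E.operator H ∈ Matrix.unitaryGroup (QubitBasis E.ancillas) ℂ :=
  foldl_mem_unitaryGroup hH _ E.initial.2

theorem norm_finalState {H : Matrix (Fin 2) (Fin 2) ℂ} (hH : H.IsHermitian) :
    ‖WithLp.toLp 2 (E.finalState H)‖ = 1 := by
  have hU := Matrix.mem_unitaryGroup_iff'.mp (E.operator_mem_unitaryGroup hH)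
  rw [← pow_eq_one_iff_of_nonneg (norm_nonneg _) two_ne_zero, ← re_star_dotProduct_self,
    finalState, Matrix.star_mulVec, ← Matrix.dotProduct_mulVec, Matrix.mulVec_mulVec,
    ← Matrix.star_eq_conjTranspose, hU, Matrix.one_mulVec, re_star_dotProduct_self, E.norm_state,
    one_pow]

theorem outcomeProb_nonneg (H : Matrix (Fin 2) (Fin 2) ℂ) (i : Fin E.outcomes) :
    0 ≤ E.outcomeProb H i := by
  obtain ⟨B, hB⟩ := exists_re_star_dotProduct_eq_norm_sq (E.povm_posSemidef i)
  rw [outcomeProb, hB]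
  positivity

theorem sum_outcomeProb {H : Matrix (Fin 2) (Fin 2) ℂ} (hH : H.IsHermitian) :
    ∑ i, E.outcomeProb H i = 1 := by
  simp only [outcomeProb]
  rw [sum_re_star_dotProduct_povm E.povm_sum, E.norm_finalState hH, one_pow]

theorem sum_abs_outcomeProb_sub_le {ε : ℝ} (hε : 0 ≤ ε) (hν : ν < 1) :
    ∑ i, |E.outcomeProb (pauliZ + (ε : ℂ) • pauliX) i - E.outcomeProb pauliZ i|
      ≤ 2 * (2 * ε * (2 * ν + ε) * E.evolutionTime
        + ε * (2 * ν + ε + 1) / (1 - ν) * E.numEvolutions) := by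
  have h₁ := pauliZ_add_smul_pauliX_isHermitian ε
  have h₀ := pauliZ_isHermitian
  refine (sum_abs_sub_le_of_povm E.povm_posSemidef E.povm_sum (E.norm_finalState h₁).le
    (E.norm_finalState h₀).le).trans (mul_le_mul_of_nonneg_left ?_ zero_le_two)
  rw [← WithLp.toLp_sub, finalState, finalState, ← Matrix.sub_mulVec]
  calc _ ≤ _ := Matrix.l2_opNorm_mulVec
        (E.operator (pauliZ + (ε : ℂ) • pauliX) - E.operator pauliZ) (WithLp.toLp 2 E.state)
    _ = _ := by rw [E.norm_state, mul_one]; rfl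
    _ ≤ _ := norm_foldl_sub_foldl_le h₁ h₀
        (fun s => s.norm_operator_sub_operator_le hε hν) E.steps (V := E.initial) E.initial.2
    _ = _ := by rw [sub_self, norm_zero, zero_add]; rfl

end Experiment

/-! ### Leaf distributions of adaptive strategies -/

namespace Strategy

variable {ν : ℝ}

theorem sum_leaf_node {E : Experiment ν} {child : Fin E.outcomes → Strategy ν}
    (f : (node E child).Leaf → ℝ) : ∑ l, f l = ∑ i, ∑ l, f ⟨i, l⟩ :=
  Fintype.sum_sigma (α := fun i => (child i).Leaf) f

theorem leafProb_nonneg (H : Matrix (Fin 2) (Fin 2) ℂ) (S : Strategy ν) (l : S.Leaf) :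
    0 ≤ S.leafProb H l := by
  induction S with
  | leaf => exact zero_le_one
  | node E child ih => exact mul_nonneg (E.outcomeProb_nonneg H _) (ih l.1 l.2)

theorem sum_leafProb {H : Matrix (Fin 2) (Fin 2) ℂ} (hH : H.IsHermitian) (S : Strategy ν) :
    ∑ l, S.leafProb H l = 1 := by
  induction S with
  | leaf => exact Fintype.sum_unique (ι := Unit) fun _ => (1 : ℝ)
  | node E child ih =>
    rw [sum_leaf_node]
    simp only [leafProb]
    simp only [← Finset.mul_sum, ih, mul_one]
    exact E.sum_outcomeProb hH

/-- If the distance of the outcome distributions of every experiment is bounded by its cost, then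
the distance of the leaf distributions is bounded by the cost of the most expensive path. -/
theorem sum_abs_leafProb_sub_le {H₁ H₀ : Matrix (Fin 2) (Fin 2) ℂ}
    (h₁ : H₁.IsHermitian) (h₀ : H₀.IsHermitian) {α β : ℝ}
    (hexp : ∀ E : Experiment ν, ∑ i, |E.outcomeProb H₁ i - E.outcomeProb H₀ i|
      ≤ 2 * (α * E.evolutionTime + β * E.numEvolutions))
    (S : Strategy ν) {C : ℝ} (hC : ∀ l, α * S.pathTime l + β * S.pathEvolutions l ≤ C) :
    ∑ l, |S.leafProb H₁ l - S.leafProb H₀ l| ≤ 2 * C := by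
  induction S generalizing C with
  | leaf =>
    have h := hC ()
    simp only [pathTime, pathEvolutions, mul_zero, Nat.cast_zero, add_zero] at h
    simp only [leafProb, sub_self, abs_zero, Finset.sum_const_zero]
    linarith
  | node E child ih =>
    -- Each child inherits the budget `C - c`, so the induction must range over all `C`.
    set c := α * E.evolutionTime + β * E.numEvolutions with hc
    have hchild : ∀ i, ∑ l, |(child i).leafProb H₁ l - (child i).leafProb H₀ l|
        ≤ 2 * (C - c) := by
      refine fun i => ih i fun l => ?_
      have h := hC ⟨i, l⟩
      simp only [pathTime, pathEvolutions] at h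
      push_cast at h
      linarith
    have hterm : ∀ i, ∑ l, |E.outcomeProb H₁ i * (child i).leafProb H₁ l
          - E.outcomeProb H₀ i * (child i).leafProb H₀ l|
        ≤ |E.outcomeProb H₁ i - E.outcomeProb H₀ i| + E.outcomeProb H₀ i * (2 * (C - c)) := by
      intro i
      -- In `pq - p'q' = (p - p')q + p'(q - q')`, summing over leaves removes `q`, and the child
      -- errors are averaged with the weights `p'`, so they are not added over the outcomes.
      have hl : ∀ l, |E.outcomeProb H₁ i * (child i).leafProb H₁ l
            - E.outcomeProb H₀ i * (child i).leafProb H₀ l|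
          ≤ |E.outcomeProb H₁ i - E.outcomeProb H₀ i| * (child i).leafProb H₁ l
            + E.outcomeProb H₀ i * |(child i).leafProb H₁ l - (child i).leafProb H₀ l| := by
        intro l
        calc _ = |(E.outcomeProb H₁ i - E.outcomeProb H₀ i) * (child i).leafProb H₁ l
              + E.outcomeProb H₀ i * ((child i).leafProb H₁ l - (child i).leafProb H₀ l)| := by
              congr 1; ring
          _ ≤ _ := abs_add_le _ _
          _ = _ := by
            rw [abs_mul, abs_mul, abs_of_nonneg (leafProb_nonneg H₁ (child i) l),
              abs_of_nonneg (E.outcomeProb_nonneg H₀ i)]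
      refine (Finset.sum_le_sum fun l _ => hl l).trans ?_
      rw [Finset.sum_add_distrib, ← Finset.mul_sum, ← Finset.mul_sum, sum_leafProb h₁, mul_one]
      have := mul_le_mul_of_nonneg_left (hchild i) (E.outcomeProb_nonneg H₀ i)
      linarith
    rw [sum_leaf_node]
    refine (Finset.sum_le_sum fun i _ => hterm i).trans ?_
    rw [Finset.sum_add_distrib, ← Finset.sum_mul, E.sum_outcomeProb h₀, one_mul]
    linarith [hexp E]

end Strategy

end AdaptiveDiscrimination

theorem theoremS5 (ε ν : ℝ) (hε : 0 ≤ ε) (hν₀ : 0 ≤ ν) (hν₁ : ν < 1)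
    (Lmax : ℕ) (Tmax : ℝ) (S : AdaptiveDiscrimination.Strategy ν)
    (hL : ∀ l : S.Leaf, S.pathEvolutions l ≤ Lmax)
    (hT : ∀ l : S.Leaf, S.pathTime l ≤ Tmax) :
    AdaptiveDiscrimination.tvDist
        (S.leafProb (AdaptiveDiscrimination.pauliZ + (ε : ℂ) • AdaptiveDiscrimination.pauliX))
        (S.leafProb AdaptiveDiscrimination.pauliZ)
      ≤ 2 * ε * (2 * ν + ε) * Tmax + ε * (2 * ν + ε + 1) / (1 - ν) * Lmax := by
  have hν : 0 < 1 - ν := sub_pos.mpr hν₁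
  have h := S.sum_abs_leafProb_sub_le
    (AdaptiveDiscrimination.pauliZ_add_smul_pauliX_isHermitian ε)
    AdaptiveDiscrimination.pauliZ_isHermitian
    (fun E => E.sum_abs_outcomeProb_sub_le hε hν₁)
    (C := 2 * ε * (2 * ν + ε) * Tmax + ε * (2 * ν + ε + 1) / (1 - ν) * Lmax) fun l => by
      have hT' := hT l
      have hL' : (S.pathEvolutions l : ℝ) ≤ Lmax := by exact_mod_cast hL l
      gcongr
  rw [AdaptiveDiscrimination.tvDist]
  linarith
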